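/- **Setting.** For each $n$ let $m=m_n$, $k=k_n$, $r=r_n\le k$, $N=N_n$ with, as $n\to\infty$, $m\to\infty$, $(\log n)/m\to 0$, $k/m\to\gamma$, $r/k\to\alpha$ and $\gamma(1+\alpha)<1$. Let $A=A_n\in\mathbb R^{m\times n}$ be a random matrix with columns $\mathbf a_1,\dots,\mathbf a_n$ and i.i.d. $\mathcal N(0,1/m)$ entries, let $X=X_n\in\mathbb R^{n\times N}$ be deterministic with exactly $k$ nonzero rows, indexed by $\operatorname{supp}X$, and let $Y=AX+W$ with $W$ a random noise matrix independent of $A$ (for each $n$). All random matrices live on one probability space. Let $\tilde S=YQ\in\mathbb R^{m\times r}$ be a rank-$r$ signal subspace estimate of $Y$: $Q=VC$, where $V\in\mathbb R^{N\times r}$ has as columns orthonormal right singular vectors of $Y$ for its $r$ largest singular values, which are almost surely positive for all large $n$, $C$ is an invertible $r\times r$ matrix, and $Q$ is a measurable function of $Y$. (So the columns of $\tilde S$ form a basis of the span of the $r$ dominant left singular vectors of $Y$.) Put $\tilde X=XQ$, let $S\in\mathbb R^{m\times r}$ be any matrix with column space $R(S)=R(A\tilde X)$, and let $\Delta=\|S-\tilde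 S\|$ (spectral norm). For an index set $T$, $A_T$ is the submatrix of the columns of $A$ indexed by $T$, $\sigma_k(\cdot)$ is the $k$-th largest singular value, and $P_R^\perp$ is the orthogonal projection onto the orthogonal complement of $R$. Let $I=I_n\subset\{1,\dots,n\}$ be deterministic with $|I|=k$, and let $I_C:=I\cap\operatorname{supp}X$ satisfy $|I_C|\ge k-r+1$. For $q\in I_C$ put $$\tilde\sigma_k(q,I)=\max\{\sigma_k([A_T\ S]) : T\subset I_C\setminus\{q\},\ |T|=k-r\},$$ and write $I_C=\{q_1,\dots,q_{|I_C|}\}$ with $\tilde\sigma_k(q_1,I)\ge\tilde\sigma_k(q_2,I)\ge\cdots\ge\tilde\sigma_k(q_{|I_C|},I)$ (ties broken arbitrarily). Let $$\zeta(j)=\big\|P^{\perp}_{R([A_{I\setminus\{j\}}\ \tilde S])}\,\mathbf a_j\big\|^2 .$$ *Support filtering* returns $k-r$ indices of $I$ that come first when $I$ is sorted by ascending $\zeta$. **Theorem.** Let $m\ge k+r$ for all large $n$. In the above setting the following implication holds with probability tending to one as $n\to\infty$, and almost surely for all sufficiently large $n$: if $$\frac{\tilde\sigma_k(q_{k-r},I)}{\Delta}>1+\frac{1}{1-\gamma(1+\alpha)}$$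 (read as $\tilde\sigma_k(q_{k-r},I)>\bigl(1+\tfrac1{1-\gamma(1+\alpha)}\bigr)\Delta$ if $\Delta=0$), then $$\min_{j\notin\operatorname{supp}X}\zeta(j)\;>\;\max_{j\in\{q_1,\dots,q_{k-r}\}}\zeta(j),$$ and hence support filtering succeeds: all $k-r$ indices that it returns belong to $\operatorname{supp}X$. (The inequality is vacuous if $r=k$ or $\operatorname{supp}X=\{1,\dots,n\}$.) -/

import Mathlib

open MeasureTheory ProbabilityTheory Filter Topology
open scoped NNReal

noncomputable section

namespace SeqMusic

/-- Matrices carry the product (Borel) sigma-algebra of their entries. -/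
instance matrixMeasurableSpace {m n : ℕ} : MeasurableSpace (Matrix (Fin m) (Fin n) ℝ) :=
  MeasurableSpace.pi

/-- The `m × n` random matrix `A` has independent entries with law `N(0, 1/m)`. -/
def IsGaussianSensing {Ω : Type*} [MeasurableSpace Ω] (μ : Measure Ω) {m n : ℕ}
    (A : Ω → Matrix (Fin m) (Fin n) ℝ) : Prop :=
  iIndepFun (fun (p : Fin m × Fin n) (ω : Ω) => A ω p.1 p.2) μ ∧
    ∀ i j, HasLaw (fun ω => A ω i j) (gaussianReal 0 ((m : ℝ≥0)⁻¹)) μ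

/-- `supp X`, the set of indices of the nonzero rows of `X`. -/
def rowSupport {n N : ℕ} (X : Matrix (Fin n) (Fin N) ℝ) : Finset (Fin n) :=
  open Classical in Finset.univ.filter fun i => X i ≠ 0

/-- The column space `R(G)`, as a subspace of Euclidean space. -/
def colSpace {m : ℕ} {ι : Type*} [Fintype ι] [DecidableEq ι] (G : Matrix (Fin m) ι ℝ) :
    Submodule ℝ (EuclideanSpace ℝ (Fin m)) :=
  LinearMap.range (Matrix.toEuclideanLin G)

/-- The spectral norm, i.e. the operator norm between Euclidean spaces. -/
def specNorm {m : ℕ} {ι : Type*} [Fintype ι] [DecidableEq ι] (G : Matrix (Fin m) ι ℝ) : ℝ :=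
  ‖LinearMap.toContinuousLinearMap (Matrix.toEuclideanLin G)‖

/-- `σ_k(G)`, the `k`-th largest singular value of `G` for `k = 1, 2, …` (Mathlib's sequence of
singular values starts at index `0`). -/
def sigma {m : ℕ} {ι : Type*} [Fintype ι] [DecidableEq ι] (k : ℕ) (G : Matrix (Fin m) ι ℝ) : ℝ :=
  (Matrix.toEuclideanLin G).singularValues (k - 1)

/-- The matrix `[A_T  S]`: the columns of `A` with index in `T`, followed by the columns of `S`. -/
def augment {m n r : ℕ} (A : Matrix (Fin m) (Fin n) ℝ) (T : Finset (Fin n))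
    (S : Matrix (Fin m) (Fin r) ℝ) : Matrix (Fin m) (T ⊕ Fin r) ℝ :=
  Matrix.fromCols (A.submatrix id (fun t : T => (t : Fin n))) S

/-- `Q` reduces the data `Y` to a rank-`r` signal subspace estimate `Y Q` by a truncated singular
value decomposition: the columns of `V` (of `U`) are orthonormal right (left) singular vectors of
`Y` for its `r` largest singular values, all of them positive, and `Q = V C` with `C` invertible.
The columns of `Y Q` are then a basis of the span of the columns of `U`; for instance
`C = diag(s)⁻¹` gives `Y Q = U`, and `C = 1` gives `Y Q = Y V`. -/
def IsSVDReduction {m N r : ℕ} (Y : Matrix (Fin m) (Fin N) ℝ) (Q : Matrix (Fin N) (Fin r) ℝ) :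
    Prop :=
  ∃ (U : Matrix (Fin m) (Fin r) ℝ) (V : Matrix (Fin N) (Fin r) ℝ) (s : Fin r → ℝ)
    (C : Matrix (Fin r) (Fin r) ℝ),
    U.transpose * U = 1 ∧ V.transpose * V = 1 ∧
    (∀ i : Fin r, s i = sigma ((i : ℕ) + 1) Y) ∧ (∀ i, 0 < s i) ∧
    Y * V = U * Matrix.diagonal s ∧ Y.transpose * U = V * Matrix.diagonal s ∧
    IsUnit C.det ∧ Q = V * C

/-- The backward filtering residual `ζ(j) = ‖P^⊥_{R[A_{I∖{j}} S]} a_j‖²`. -/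
def residual {m n r : ℕ} (A : Matrix (Fin m) (Fin n) ℝ) (S : Matrix (Fin m) (Fin r) ℝ)
    (I : Finset (Fin n)) (j : Fin n) : ℝ :=
  ‖(colSpace (augment A (I.erase j) S))ᗮ.starProjection
      (WithLp.toLp 2 (fun i => A i j) : EuclideanSpace ℝ (Fin m))‖ ^ 2

/-- `σ̃(q, I) = max {σ_k([A_T S]) : T ⊆ I_C ∖ {q}, |T| = k - r}`, where `C` stands for `I_C`.
This is the supremum of a finite set. -/
def sigmaTilde {m n r : ℕ} (k : ℕ) (A : Matrix (Fin m) (Fin n) ℝ) (S : Matrix (Fin m) (Fin r) ℝ)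
    (C : Finset (Fin n)) (q : Fin n) : ℝ :=
  sSup {x : ℝ | ∃ T : Finset (Fin n), T ⊆ C.erase q ∧ T.card = k - r ∧ x = sigma k (augment A T S)}

/-- `q 1, …, q |C|` enumerates `C` so that `f (q 1) ≥ f (q 2) ≥ … ≥ f (q |C|)`. -/
def IsDescendingEnum {n : ℕ} (f : Fin n → ℝ) (C : Finset (Fin n)) (q : ℕ → Fin n) : Prop :=
  Set.BijOn q (Set.Icc 1 C.card) (C : Set (Fin n)) ∧
    AntitoneOn (fun i => f (q i)) (Set.Icc 1 C.card)

/-- `J` is a possible output of support filtering: `p` indices of `I` that come first when `I` is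
sorted by ascending `ζ` (ties being broken arbitrarily). -/
def IsFilteringOutput {n : ℕ} (ζ : Fin n → ℝ) (I : Finset (Fin n)) (p : ℕ) (J : Finset (Fin n)) :
    Prop :=
  J ⊆ I ∧ J.card = p ∧ ∀ a ∈ J, ∀ b ∈ I \ J, ζ a ≤ ζ b

/-- For sensing matrix `A`, true support `supp`, noiseless and estimated signal subspace matrices
`S` and `St`, and index set `I`: if `σ̃(q_{k-r}, I) > c ‖S - St‖`, where `q_1, q_2, …` lists
`I_C = supp ∩ I` in descending order of `σ̃(·, I)`, then the filtering residual of every index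
outside the support exceeds those of `q_1, …, q_{k-r}`, and support filtering returns `k - r`
correct indices. -/
def FilteringSucceedsIfSNR {m n r : ℕ} (k : ℕ) (c : ℝ) (A : Matrix (Fin m) (Fin n) ℝ)
    (supp I : Finset (Fin n)) (S St : Matrix (Fin m) (Fin r) ℝ) : Prop :=
  ∀ q : ℕ → Fin n, IsDescendingEnum (sigmaTilde k A S (supp ∩ I)) (supp ∩ I) q →
    sigmaTilde k A S (supp ∩ I) (q (k - r)) > c * specNorm (S - St) →
      (∀ j, j ∉ supp → ∀ i ∈ Set.Icc 1 (k - r),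
        residual A St I j > residual A St I (q i)) ∧
      (∀ J, IsFilteringOutput (residual A St I) I (k - r) J → J ⊆ supp)

end SeqMusic

end

/-! Write β = 1 - γ(1 + α). The residuals of good indices are bounded deterministically, those of
indices off the support by concentration.

Upper bound (`sigma_sq_mul_residual_le`): if σ = σ_k([A_T S]) is positive, the k columns of [A_T S]
span R(A_supp), so a_q = [A_T S]x with ‖x‖ ≤ ‖a_q‖/σ. Replacing S by the estimate moves this vector
by at most Δ‖x‖ and lands in the space defining ζ(q), so σ²ζ(q) ≤ Δ²‖a_q‖². When σ > (1 + 1/β)Δ, the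
inequality (1 + 1/β)² ≥ 4/β gives ζ(q) ≤ (β/4)‖a_q‖².

Lower bound (`IsGaussianSensing.measure_residual_lt_le`): for j off the support, AX does not involve
a_j, so a_j is independent of the subspace it is projected away from. That subspace has dimension at
most k + r ≈ (1 - β)m, so ζ(j) is typically at least about β.

The factor 4 leaves room for crude chi-square tails: ‖a_q‖² ≤ 3/2 and ζ(j) ≥ β/2 suffice, as 3β/8 <
β/2. Failures have probability exponentially small in m; since log n = o(m), a union bound over n
columns leaves 2/n², and Borel–Cantelli applies. -/

namespace SeqMusic

/-! ### Deterministic perturbation bounds for the residuals. -/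

section Deterministic

/-- Expand x in an eigenbasis of T*T. The domain has dimension k, so the zero-based index `k - 1` is
that of the smallest singular value. -/
theorem minSingularValue_mul_norm_le {E F : Type*} [NormedAddCommGroup E] [InnerProductSpace ℝ E]
    [FiniteDimensional ℝ E] [NormedAddCommGroup F] [InnerProductSpace ℝ F]
    [FiniteDimensional ℝ F] (T : E →ₗ[ℝ] F) {k : ℕ} (hk : Module.finrank ℝ E = k) (h0 : 0 < k)
    (x : E) : T.singularValues (k - 1) * ‖x‖ ≤ ‖T x‖ := by
  have hT := T.isSymmetric_adjoint_comp_self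
  set b := hT.eigenvectorBasis hk with hb
  have hx : ‖x‖ ^ 2 = ∑ i, inner ℝ (b i) x ^ 2 := by
    rw [← b.sum_sq_inner_right x]
  have hTx : ‖T x‖ ^ 2 = ∑ i : Fin k, T.singularValues (i : ℕ) ^ 2 * inner ℝ (b i) x ^ 2 := by
    rw [← real_inner_self_eq_norm_sq, ← LinearMap.adjoint_inner_left, ← LinearMap.comp_apply,
      ← b.sum_inner_mul_inner]
    refine Finset.sum_congr rfl fun i _ => ?_
    rw [T.sq_singularValues_fin hk i, hT, hb, hT.apply_eigenvectorBasis, inner_smul_right,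
      real_inner_comm x]
    simp
    ring
  refine le_of_sq_le_sq ?_ (norm_nonneg _)
  rw [mul_pow, hTx, hx, Finset.mul_sum]
  refine Finset.sum_le_sum fun i _ => mul_le_mul_of_nonneg_right ?_ (sq_nonneg _)
  exact pow_le_pow_left₀ (T.singularValues_nonneg _)
    (T.singularValues_antitone (by omega)) 2

/-- The `j`-th column of a matrix as a point of Euclidean space. -/
noncomputable def colVec {m : ℕ} {ι : Type*} (G : Matrix (Fin m) ι ℝ) (j : ι) :
    EuclideanSpace ℝ (Fin m) :=
  WithLp.toLp 2 fun i => G i j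

theorem toEuclideanLin_eq_sum {m : ℕ} {ι : Type*} [Fintype ι] [DecidableEq ι]
    (G : Matrix (Fin m) ι ℝ) (x : EuclideanSpace ℝ ι) :
    Matrix.toEuclideanLin G x = ∑ j, x j • colVec G j := by
  ext i
  simp [Matrix.toEuclideanLin, Matrix.mulVec, dotProduct, colVec, mul_comm]

theorem colSpace_eq_span {m : ℕ} {ι : Type*} [Fintype ι] [DecidableEq ι]
    (G : Matrix (Fin m) ι ℝ) : colSpace G = Submodule.span ℝ (Set.range (colVec G)) := by
  apply le_antisymm
  · rintro _ ⟨x, rfl⟩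
    rw [toEuclideanLin_eq_sum]
    exact Submodule.sum_mem _ fun j _ =>
      Submodule.smul_mem _ _ (Submodule.subset_span (Set.mem_range_self j))
  · rw [Submodule.span_le]
    rintro _ ⟨j, rfl⟩
    refine ⟨EuclideanSpace.single j 1, ?_⟩
    rw [toEuclideanLin_eq_sum]
    simp

theorem colSpace_augment {m n r : ℕ} (A : Matrix (Fin m) (Fin n) ℝ) (T : Finset (Fin n))
    (S : Matrix (Fin m) (Fin r) ℝ) :
    colSpace (augment A T S) = Submodule.span ℝ (colVec A '' T) ⊔ colSpace S := by
  rw [colSpace_eq_span, colSpace_eq_span, ← Submodule.span_union]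
  congr 1
  ext v
  simp only [Set.mem_range, Set.mem_union, Set.mem_image, Sum.exists]
  refine or_congr ?_ Iff.rfl
  constructor
  · rintro ⟨t, rfl⟩
    exact ⟨t, t.2, rfl⟩
  · rintro ⟨t, ht, rfl⟩
    exact ⟨⟨t, ht⟩, rfl⟩

theorem colSpace_augment_mono {m n r : ℕ} (A : Matrix (Fin m) (Fin n) ℝ) {T T' : Finset (Fin n)}
    (h : T ⊆ T') (S : Matrix (Fin m) (Fin r) ℝ) :
    colSpace (augment A T S) ≤ colSpace (augment A T' S) := by
  rw [colSpace_augment, colSpace_augment]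
  exact sup_le_sup_right (Submodule.span_mono (Set.image_mono (by exact_mod_cast h))) _

theorem colSpace_mul_le_span_rowSupport {m n N r : ℕ} (A : Matrix (Fin m) (Fin n) ℝ)
    (X : Matrix (Fin n) (Fin N) ℝ) (Q : Matrix (Fin N) (Fin r) ℝ) :
    colSpace (A * (X * Q)) ≤ Submodule.span ℝ (colVec A '' rowSupport X) := by
  rw [colSpace_eq_span, Submodule.span_le]
  rintro _ ⟨j, rfl⟩
  have : colVec (A * (X * Q)) j = ∑ l, (X * Q) l j • colVec A l := by
    ext i
    simp [colVec, Matrix.mul_apply (M := A), mul_comm]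
  rw [this]
  refine Submodule.sum_mem _ fun l _ => ?_
  by_cases hl : l ∈ rowSupport X
  · exact Submodule.smul_mem _ _ (Submodule.subset_span ⟨l, hl, rfl⟩)
  · have h0 : X l = 0 := by simpa [rowSupport] using hl
    have : (X * Q) l j = 0 := by simp [Matrix.mul_apply, h0]
    rw [this, zero_smul]
    exact Submodule.zero_mem _

theorem finrank_span_image_le {m n : ℕ} (A : Matrix (Fin m) (Fin n) ℝ) (T : Finset (Fin n)) :
    Module.finrank ℝ (Submodule.span ℝ (colVec A '' T)) ≤ T.card := by
  classical
  have := finrank_span_finset_le_card (R := ℝ) (T.image (colVec A))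
  rw [Finset.coe_image] at this
  exact this.trans Finset.card_image_le

theorem finrank_colSpace_le {m : ℕ} {ι : Type*} [Fintype ι] [DecidableEq ι]
    (G : Matrix (Fin m) ι ℝ) : Module.finrank ℝ (colSpace G) ≤ Fintype.card ι := by
  refine (LinearMap.finrank_range_le _).trans ?_
  simp

/-- The projection kills y, so any single element of K serves as a witness for an upper bound on the
residual. -/
theorem norm_orthogonal_starProjection_le {E : Type*} [NormedAddCommGroup E]
    [InnerProductSpace ℝ E] [FiniteDimensional ℝ E] (K : Submodule ℝ E) (v : E) {y : E}
    (hy : y ∈ K) : ‖Kᗮ.starProjection v‖ ≤ ‖v - y‖ := by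
  have h : Kᗮ.starProjection v = Kᗮ.starProjection (v - y) := by
    have h0 : Kᗮ.starProjection y = 0 :=
      (Submodule.starProjection_apply_eq_zero_iff _).2 (by simpa using hy)
    rw [map_sub, h0, sub_zero]
  rw [h]
  exact Submodule.norm_starProjection_apply_le _ _

theorem residual_le {m n r : ℕ} (A : Matrix (Fin m) (Fin n) ℝ) (St : Matrix (Fin m) (Fin r) ℝ)
    (I : Finset (Fin n)) (j : Fin n) {y : EuclideanSpace ℝ (Fin m)}
    (hy : y ∈ colSpace (augment A (I.erase j) St)) :
    residual A St I j ≤ ‖colVec A j - y‖ ^ 2 :=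
  pow_le_pow_left₀ (norm_nonneg _) (norm_orthogonal_starProjection_le _ _ hy) 2

/-- The two matrices share the block A_T, so only the coordinates of x on the S block contribute. -/
theorem norm_augment_sub_le {m n r : ℕ} (A : Matrix (Fin m) (Fin n) ℝ) (T : Finset (Fin n))
    (S St : Matrix (Fin m) (Fin r) ℝ) (x : EuclideanSpace ℝ (T ⊕ Fin r)) :
    ‖Matrix.toEuclideanLin (augment A T S) x - Matrix.toEuclideanLin (augment A T St) x‖ ≤
      specNorm (S - St) * ‖x‖ := by
  set z : EuclideanSpace ℝ (Fin r) := WithLp.toLp 2 fun i => x (Sum.inr i) with hz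
  have h : Matrix.toEuclideanLin (augment A T S) x - Matrix.toEuclideanLin (augment A T St) x =
      Matrix.toEuclideanLin (S - St) z := by
    ext i
    simp [toEuclideanLin_eq_sum, colVec, augment, hz, Matrix.mulVec, dotProduct, mul_comm]
  have hzx : ‖z‖ ≤ ‖x‖ := by
    refine le_of_sq_le_sq ?_ (norm_nonneg _)
    rw [EuclideanSpace.real_norm_sq_eq, EuclideanSpace.real_norm_sq_eq, Fintype.sum_sum_type]
    exact le_add_of_nonneg_left (Finset.sum_nonneg fun i _ => sq_nonneg _)
  rw [h]
  exact ((Matrix.toEuclideanLin (S - St)).toContinuousLinearMap.le_opNorm z).trans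
    (mul_le_mul_of_nonneg_left hzx (norm_nonneg _))

/-- If `[A_T S]` has full column rank `k = |supp|` and its columns lie in `R(A_supp)`, then the
residual of a support index is controlled by the perturbation of the signal subspace matrix. -/
theorem sigma_sq_mul_residual_le {m n r k : ℕ} (A : Matrix (Fin m) (Fin n) ℝ)
    (S St : Matrix (Fin m) (Fin r) ℝ) {supp I T : Finset (Fin n)} {q : Fin n}
    (hsupp : supp.card = k) (hk : 0 < k) (hr : r ≤ k) (hTc : T.card = k - r)
    (hT : T ⊆ (supp ∩ I).erase q) (hq : q ∈ supp)
    (hS : colSpace S ≤ Submodule.span ℝ (colVec A '' supp))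
    (hσ : 0 < sigma k (augment A T S)) :
    sigma k (augment A T S) ^ 2 * residual A St I q ≤
      specNorm (S - St) ^ 2 * ‖colVec A q‖ ^ 2 := by
  have hdim : Module.finrank ℝ (EuclideanSpace ℝ (T ⊕ Fin r)) = k := by simp; omega
  have hle : colSpace (augment A T S) ≤ Submodule.span ℝ (colVec A '' supp) := by
    rw [colSpace_augment]
    refine sup_le (Submodule.span_mono (Set.image_mono fun t ht => ?_)) hS
    exact (Finset.mem_inter.1 (Finset.mem_of_mem_erase (hT ht))).1
  -- A positive k-th singular value means rank at least k, while R(A_supp) has dimension at most k;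
  -- the inclusion `hle` is therefore an equality.
  have hrank : k ≤ Module.finrank ℝ (colSpace (augment A T S)) := by
    have := (LinearMap.singularValues_pos_iff_lt_finrank_range _).1 hσ
    unfold colSpace
    omega
  have heq : colSpace (augment A T S) = Submodule.span ℝ (colVec A '' supp) :=
    Submodule.eq_of_le_of_finrank_le hle (((finrank_span_image_le A supp).trans hsupp.le).trans hrank)
  have hmem : colVec A q ∈ colSpace (augment A T S) := by
    rw [heq]
    exact Submodule.subset_span ⟨q, hq, rfl⟩
  obtain ⟨x, hx⟩ := hmem
  have hxn : sigma k (augment A T S) * ‖x‖ ≤ ‖colVec A q‖ := by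
    rw [← hx]
    exact minSingularValue_mul_norm_le _ hdim hk x
  have hres : residual A St I q ≤ (specNorm (S - St) * ‖x‖) ^ 2 := by
    have hTI : T ⊆ I.erase q := fun t ht => by
      have := hT ht
      simp only [Finset.mem_erase, Finset.mem_inter] at this ⊢
      tauto
    refine (residual_le A St I q
      (colSpace_augment_mono A hTI St ⟨x, rfl⟩)).trans ?_
    rw [← hx]
    exact pow_le_pow_left₀ (norm_nonneg _) (norm_augment_sub_le A T S St x) 2
  calc sigma k (augment A T S) ^ 2 * residual A St I q
      ≤ sigma k (augment A T S) ^ 2 * (specNorm (S - St) * ‖x‖) ^ 2 := by gcongr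
    _ = specNorm (S - St) ^ 2 * (sigma k (augment A T S) * ‖x‖) ^ 2 := by ring
    _ ≤ specNorm (S - St) ^ 2 * ‖colVec A q‖ ^ 2 := by
      gcongr

theorem exists_sigma_eq_sigmaTilde {m n r k : ℕ} (A : Matrix (Fin m) (Fin n) ℝ)
    (S : Matrix (Fin m) (Fin r) ℝ) (C : Finset (Fin n)) (q : Fin n)
    (h : 0 < sigmaTilde k A S C q) :
    ∃ T, T ⊆ C.erase q ∧ T.card = k - r ∧ sigma k (augment A T S) = sigmaTilde k A S C q := by
  set s := {x : ℝ | ∃ T : Finset (Fin n), T ⊆ C.erase q ∧ T.card = k - r ∧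
    x = sigma k (augment A T S)} with hs
  have hfin : s.Finite := by
    refine (Set.finite_range fun T : Finset (Fin n) => sigma k (augment A T S)).subset ?_
    rintro _ ⟨T, -, -, rfl⟩
    exact ⟨T, rfl⟩
  -- With no admissible T the supremum would be the default `sSup ∅ = 0`, against positivity.
  have hne : s.Nonempty := by
    rw [Set.nonempty_iff_ne_empty]
    intro h0
    have : sigmaTilde k A S C q = sSup s := rfl
    rw [this, h0, Real.sSup_empty] at h
    exact lt_irrefl _ h
  obtain ⟨T, h1, h2, h3⟩ := hne.csSup_mem hfin
  exact ⟨T, h1, h2, h3.symm⟩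

/-- Exchange argument: as |J| = |P|, a wrong index in J forces some i ∈ P out of J, although ζ ranks
i strictly earlier. -/
theorem subset_of_isFilteringOutput {n p : ℕ} {ζ : Fin n → ℝ} {supp I J P : Finset (Fin n)}
    (hP : P ⊆ supp ∩ I) (hPc : P.card = p) (hζ : ∀ j ∉ supp, ∀ i ∈ P, ζ i < ζ j)
    (hJ : IsFilteringOutput ζ I p J) : J ⊆ supp := by
  obtain ⟨hJI, hJc, hmin⟩ := hJ
  intro j hj
  by_contra hjs
  have hjP : j ∉ P := fun h => hjs (Finset.mem_inter.1 (hP h)).1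
  obtain ⟨i, hiP, hiJ⟩ : ∃ i ∈ P, i ∉ J := by
    by_contra! hcon
    have : P = J := Finset.eq_of_subset_of_card_le hcon (by omega)
    exact hjP (this ▸ hj)
  have h1 := hmin j hj i (Finset.mem_sdiff.2 ⟨(Finset.mem_inter.1 (hP hiP)).2, hiJ⟩)
  exact absurd (hζ j hjs i hiP) (not_lt.2 h1)

/-- The constants 3/2 and β/2 suffice because the threshold 1 + 1/β already yields Δ²/σ² ≤ β/4, so
good residuals are at most (3/2)(β/4) = 3β/8. -/
theorem filteringSucceedsIfSNR_of_bounds {m n r k : ℕ} {β : ℝ} (hβ : 0 < β)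
    (A : Matrix (Fin m) (Fin n) ℝ) (S St : Matrix (Fin m) (Fin r) ℝ) {supp I : Finset (Fin n)}
    (hsupp : supp.card = k) (hr : r ≤ k) (hIC : k - r + 1 ≤ (supp ∩ I).card)
    (hS : colSpace S ≤ Submodule.span ℝ (colVec A '' supp))
    (hcol : ∀ q, ‖colVec A q‖ ^ 2 ≤ 3 / 2)
    (hres : ∀ j ∉ supp, β / 2 ≤ residual A St I j) :
    FilteringSucceedsIfSNR k (1 + 1 / β) A supp I S St := by
  intro q hq hsnr
  have key : ∀ j, j ∉ supp → ∀ i ∈ Set.Icc 1 (k - r),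
      residual A St I j > residual A St I (q i) := by
    intro j hj i hi
    obtain ⟨hi1, hi2⟩ := hi
    have hΔ : 0 ≤ specNorm (S - St) := norm_nonneg _
    have hc : 0 < 1 + 1 / β := by positivity
    have hiC : i ∈ Set.Icc 1 (supp ∩ I).card := ⟨hi1, by omega⟩
    have hmono : sigmaTilde k A S (supp ∩ I) (q (k - r)) ≤ sigmaTilde k A S (supp ∩ I) (q i) :=
      hq.2 hiC ⟨by omega, by omega⟩ hi2
    have hlt := lt_of_lt_of_le hsnr hmono
    have hpos : 0 < sigmaTilde k A S (supp ∩ I) (q i) :=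
      lt_of_le_of_lt (mul_nonneg hc.le hΔ) hlt
    obtain ⟨T, hT, hTc, hTσ⟩ := exists_sigma_eq_sigmaTilde A S _ _ hpos
    have hqm : q i ∈ supp ∩ I := by exact_mod_cast hq.1.mapsTo hiC
    rw [← hTσ] at hlt hpos
    have hb := sigma_sq_mul_residual_le A S St hsupp (by omega) hr hTc hT
      (Finset.mem_inter.1 hqm).1 hS hpos
    have hcq := hcol (q i)
    have hrj := hres j hj
    set σ := sigma k (augment A T S)
    set Δ := specNorm (S - St)
    set ρ := residual A St I (q i)
    -- Arithmetic–geometric mean inequality: the difference is the square (1 - 1/β)².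
    have hc2 : 4 / β ≤ (1 + 1 / β) ^ 2 := by
      rw [← sub_nonneg]
      have : (1 + 1 / β) ^ 2 - 4 / β = (1 - 1 / β) ^ 2 := by field_simp; ring
      rw [this]
      positivity
    have h1 : ((1 + 1 / β) * Δ) ^ 2 ≤ σ ^ 2 :=
      pow_le_pow_left₀ (mul_nonneg hc.le hΔ) hlt.le 2
    have h2 : 4 * Δ ^ 2 ≤ β * σ ^ 2 := by
      have : 4 / β * Δ ^ 2 ≤ σ ^ 2 := by
        rw [mul_pow] at h1
        exact (mul_le_mul_of_nonneg_right hc2 (sq_nonneg _)).trans h1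
      calc 4 * Δ ^ 2 = β * (4 / β * Δ ^ 2) := by field_simp
        _ ≤ β * σ ^ 2 := by gcongr
    have h3 : σ ^ 2 * ρ ≤ σ ^ 2 * (3 * β / 8) := by
      have : Δ ^ 2 * ‖colVec A (q i)‖ ^ 2 ≤ Δ ^ 2 * (3 / 2) := by gcongr
      nlinarith
    have h4 : ρ ≤ 3 * β / 8 := le_of_mul_le_mul_left h3 (by positivity)
    show ρ < residual A St I j
    linarith
  refine ⟨key, fun J hJ => ?_⟩
  classical
  have hinj : Set.InjOn q (Set.Icc 1 (k - r)) :=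
    hq.1.injOn.mono (Set.Icc_subset_Icc_right (by omega))
  refine subset_of_isFilteringOutput (P := (Finset.Icc 1 (k - r)).image q) ?_ ?_ ?_ hJ
  · intro x hx
    obtain ⟨i, hi, rfl⟩ := Finset.mem_image.1 hx
    rw [Finset.mem_Icc] at hi
    exact_mod_cast hq.1.mapsTo (show i ∈ Set.Icc 1 (supp ∩ I).card from ⟨hi.1, by omega⟩)
  · rw [Finset.card_image_of_injOn (by simpa using hinj)]
    simp
  · intro j hj x hx
    obtain ⟨i, hi, rfl⟩ := Finset.mem_image.1 hx
    exact key j hj i (by simpa using hi)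

end Deterministic

/-! ### Chi-square tails for standard Gaussian vectors. -/

section ChiSquare

theorem integrable_exp_mul_sq_gaussianReal {c : ℝ} (hc : c < 1 / 2) :
    Integrable (fun x : ℝ => Real.exp (c * x ^ 2)) (gaussianReal 0 1) := by
  rw [gaussianReal_of_var_ne_zero _ one_ne_zero, integrable_withDensity_iff_integrable_smul'
    (measurable_gaussianPDF 0 1) (ae_of_all _ fun _ => gaussianPDF_lt_top)]
  have := (integrable_exp_neg_mul_sq (b := 1 / 2 - c) (by linarith)).const_mul (√(2 * Real.pi))⁻¹
  refine this.congr (ae_of_all _ fun x => ?_)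
  simp only [toReal_gaussianPDF, gaussianPDFReal, smul_eq_mul, NNReal.coe_one, mul_one, sub_zero]
  rw [mul_assoc, ← Real.exp_add]
  ring_nf

theorem integral_exp_mul_sq_gaussianReal {c : ℝ} (hc : c < 1 / 2) :
    ∫ x : ℝ, Real.exp (c * x ^ 2) ∂gaussianReal 0 1 = √(1 / (1 - 2 * c)) := by
  rw [integral_gaussianReal_eq_integral_smul one_ne_zero]
  have h : ∀ x : ℝ, gaussianPDFReal 0 1 x • Real.exp (c * x ^ 2) =
      (√(2 * Real.pi))⁻¹ * Real.exp (-(1 / 2 - c) * x ^ 2) := by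
    intro x
    simp only [gaussianPDFReal, smul_eq_mul, NNReal.coe_one, mul_one, sub_zero]
    rw [mul_assoc, ← Real.exp_add]
    ring_nf
  simp_rw [h]
  rw [integral_const_mul, integral_gaussian, ← Real.sqrt_inv, ← Real.sqrt_mul (by positivity)]
  congr 1
  have : (1 / 2 - c) ≠ 0 := by linarith
  have h2 : 1 - 2 * c ≠ 0 := by linarith
  have h3 := Real.pi_ne_zero
  field_simp

variable {E : Type*} [NormedAddCommGroup E] [InnerProductSpace ℝ E] [FiniteDimensional ℝ E]

theorem norm_sum_smul_stdOrthonormalBasis_sq (x : Fin (Module.finrank ℝ E) → ℝ) :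
    ‖∑ i, x i • stdOrthonormalBasis ℝ E i‖ ^ 2 = ∑ i, x i ^ 2 := by
  rw [← real_inner_self_eq_norm_sq, (stdOrthonormalBasis ℝ E).orthonormal.inner_sum]
  simp [sq]

variable [MeasurableSpace E] [BorelSpace E]

theorem integrable_exp_mul_norm_sq_stdGaussian {c : ℝ} (hc : c < 1 / 2) :
    Integrable (fun x : E => Real.exp (c * ‖x‖ ^ 2)) (stdGaussian E) := by
  rw [stdGaussian, integrable_map_measure (by fun_prop) (Measurable.aemeasurable (by fun_prop))]
  have := Integrable.fintype_prod (ι := Fin (Module.finrank ℝ E))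
    (fun _ => integrable_exp_mul_sq_gaussianReal hc)
  refine this.congr (ae_of_all _ fun x => ?_)
  simp only [Function.comp_apply]
  rw [norm_sum_smul_stdOrthonormalBasis_sq, Finset.mul_sum, Real.exp_sum]

theorem mgf_norm_sq_stdGaussian {c : ℝ} (hc : c < 1 / 2) :
    mgf (fun x : E => ‖x‖ ^ 2) (stdGaussian E) c =
      √(1 / (1 - 2 * c)) ^ Module.finrank ℝ E := by
  rw [mgf, stdGaussian, integral_map (Measurable.aemeasurable (by fun_prop)) (by fun_prop)]
  simp_rw [norm_sum_smul_stdOrthonormalBasis_sq, Finset.mul_sum, Real.exp_sum]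
  rw [integral_fintype_prod_eq_prod (f := fun _ (x : ℝ) => Real.exp (c * x ^ 2))]
  simp [integral_exp_mul_sq_gaussianReal hc]

theorem sqrt_pow_le_exp {a b : ℝ} (hab : a ≤ Real.exp (2 * b)) (p : ℕ) :
    √a ^ p ≤ Real.exp (p * b) := by
  rw [Real.exp_nat_mul]
  refine pow_le_pow_left₀ (Real.sqrt_nonneg _) (Real.sqrt_le_iff.2 ⟨(Real.exp_pos _).le, ?_⟩) p
  rw [← Real.exp_nat_mul]
  exact_mod_cast hab

/-- Chernoff bound at parameter -1/4. In dimension p the factor (2/3)^(p/2) is at most exp(-p/6),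
and 5/32 - 1/6 = -1/96. -/
theorem stdGaussian_real_norm_sq_le {t : ℝ} (ht : t ≤ 5 / 8 * Module.finrank ℝ E) :
    (stdGaussian E).real {x | ‖x‖ ^ 2 ≤ t} ≤ Real.exp (-(Module.finrank ℝ E / 96 : ℝ)) := by
  have h := measure_le_le_exp_mul_mgf (X := fun x : E => ‖x‖ ^ 2) (μ := stdGaussian E)
    (t := -(1 / 4)) t (by norm_num) (integrable_exp_mul_norm_sq_stdGaussian (by norm_num))
  refine h.trans ?_
  rw [mgf_norm_sq_stdGaussian (by norm_num)]
  have h1 : (1 / (1 - 2 * (-(1 / 4))) : ℝ) ≤ Real.exp (2 * (-(1 / 6))) := by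
    have := Real.add_one_le_exp (-(1 / 3) : ℝ)
    norm_num at this ⊢
    exact this
  refine (mul_le_mul_of_nonneg_left (sqrt_pow_le_exp h1 _) (Real.exp_pos _).le).trans ?_
  rw [← Real.exp_add, Real.exp_le_exp]
  linarith

/-- Chernoff bound at parameter 1/8. Here (4/3)^(p/2) ≤ exp(p/6), and 1/6 - 3/16 = -1/48, which is
weakened to -1/96. -/
theorem stdGaussian_real_le_norm_sq {t : ℝ} (ht : 3 / 2 * Module.finrank ℝ E ≤ t) :
    (stdGaussian E).real {x | t ≤ ‖x‖ ^ 2} ≤ Real.exp (-(Module.finrank ℝ E / 96 : ℝ)) := by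
  have h := measure_ge_le_exp_mul_mgf (X := fun x : E => ‖x‖ ^ 2) (μ := stdGaussian E)
    (t := 1 / 8) t (by norm_num) (integrable_exp_mul_norm_sq_stdGaussian (by norm_num))
  refine h.trans ?_
  rw [mgf_norm_sq_stdGaussian (by norm_num)]
  have h1 : (1 / (1 - 2 * (1 / 8)) : ℝ) ≤ Real.exp (2 * (1 / 6)) := by
    have := Real.add_one_le_exp (1 / 3 : ℝ)
    norm_num at this ⊢
    exact this
  refine (mul_le_mul_of_nonneg_left (sqrt_pow_le_exp h1 _) (Real.exp_pos _).le).trans ?_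
  rw [← Real.exp_add, Real.exp_le_exp]
  have : (0 : ℝ) ≤ Module.finrank ℝ E := Nat.cast_nonneg _
  linarith

/-- Orthogonal projections map standard Gaussians to standard Gaussians. -/
theorem stdGaussian_map_orthogonalProjection (K : Submodule ℝ E) :
    (stdGaussian E).map K.orthogonalProjectionOnto = stdGaussian K := by
  apply Measure.ext_of_charFunDual
  ext L
  -- The characteristic functional of a standard Gaussian depends on L only through ‖L‖; composing
  -- with a projection preserves this norm, since the projection is a contraction fixing K.
  have hn : ‖L.comp K.orthogonalProjectionOnto‖ = ‖L‖ := by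
    apply le_antisymm
    · refine (L.opNorm_comp_le _).trans ?_
      exact mul_le_of_le_one_right (norm_nonneg _) K.orthogonalProjectionOnto_norm_le
    · refine L.opNorm_le_bound (norm_nonneg _) fun x => ?_
      have := (L.comp K.orthogonalProjectionOnto).le_opNorm (x : E)
      simpa using this
  rw [charFunDual_map, charFunDual_stdGaussian, charFunDual_stdGaussian, hn]

end ChiSquare

/-! ### Tails for a single column with N(0, 1/m) entries. -/

section Columns

/-- The law of a vector with `m` independent `N(0, 1/m)` entries. -/
noncomputable def columnLaw (m : ℕ) : Measure (Fin m → ℝ) :=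
  Measure.pi fun _ => gaussianReal 0 ((m : ℝ≥0)⁻¹)

instance isProbabilityMeasure_columnLaw (m : ℕ) : IsProbabilityMeasure (columnLaw m) := by
  unfold columnLaw
  infer_instance

theorem columnLaw_map_toLp (m : ℕ) :
    (columnLaw m).map (WithLp.toLp 2) =
      (stdGaussian (EuclideanSpace ℝ (Fin m))).map fun x => (√m)⁻¹ • x := by
  have h : columnLaw m = (Measure.pi fun _ : Fin m => gaussianReal 0 1).map
      fun x i => (√m)⁻¹ * x i := by
    rw [Measure.pi_map_pi (fun i => by fun_prop)]
    unfold columnLaw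
    congr 1
    ext1 i
    rw [gaussianReal_map_const_mul, mul_zero, mul_one]
    congr 1
    ext
    simp
  rw [h, ← map_pi_eq_stdGaussian, Measure.map_map (by fun_prop) (by fun_prop),
    Measure.map_map (by fun_prop) (by fun_prop)]
  rfl

theorem columnLaw_norm_sq_gt {m : ℕ} (hm : 0 < m) :
    columnLaw m {a | 3 / 2 < ‖(WithLp.toLp 2 a : EuclideanSpace ℝ (Fin m))‖ ^ 2} ≤
      ENNReal.ofReal (Real.exp (-(m / 96 : ℝ))) := by
  have hms : MeasurableSet {x : EuclideanSpace ℝ (Fin m) | 3 / 2 < ‖x‖ ^ 2} :=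
    measurableSet_lt (by fun_prop) (by fun_prop)
  have hm' : (0 : ℝ) < m := by exact_mod_cast hm
  have h1 : columnLaw m {a | 3 / 2 < ‖(WithLp.toLp 2 a : EuclideanSpace ℝ (Fin m))‖ ^ 2} =
      (stdGaussian (EuclideanSpace ℝ (Fin m))) {x | 3 / 2 < ‖(√m)⁻¹ • x‖ ^ 2} := by
    have := congrArg (fun ν => ν {x : EuclideanSpace ℝ (Fin m) | 3 / 2 < ‖x‖ ^ 2})
      (columnLaw_map_toLp m)
    simp only at this
    rwa [Measure.map_apply (by fun_prop) hms, Measure.map_apply (by fun_prop) hms] at this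
  rw [h1, ← ofReal_measureReal]
  refine ENNReal.ofReal_le_ofReal ?_
  have h2 := stdGaussian_real_le_norm_sq (E := EuclideanSpace ℝ (Fin m)) (t := 3 / 2 * m)
    (by simp)
  rw [finrank_euclideanSpace_fin] at h2
  refine (measureReal_mono fun x hx => ?_).trans h2
  simp only [Set.mem_ofPred_eq, norm_smul, mul_pow, norm_inv, Real.norm_eq_abs, inv_pow, sq_abs,
    Real.sq_sqrt hm'.le] at hx ⊢
  rw [inv_mul_eq_div, lt_div_iff₀ hm'] at hx
  exact hx.le

theorem columnLaw_norm_projection_sq_lt {m : ℕ} {β : ℝ} (hm : 0 < m)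
    (F : Submodule ℝ (EuclideanSpace ℝ (Fin m)))
    (hF : Module.finrank ℝ F + 4 / 5 * β * m ≤ m) :
    columnLaw m {a | ‖Fᗮ.starProjection (WithLp.toLp 2 a : EuclideanSpace ℝ (Fin m))‖ ^ 2 <
      β / 2} ≤ ENNReal.ofReal (Real.exp (-(β * m / 120))) := by
  have hms : MeasurableSet {x : EuclideanSpace ℝ (Fin m) | ‖Fᗮ.starProjection x‖ ^ 2 < β / 2} :=
    measurableSet_lt (by fun_prop) (by fun_prop)
  have hm' : (0 : ℝ) < m := by exact_mod_cast hm
  have hp : (Module.finrank ℝ F : ℝ) + Module.finrank ℝ Fᗮ = m := by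
    have := F.finrank_add_finrank_orthogonal
    rw [finrank_euclideanSpace_fin] at this
    exact_mod_cast this
  have h1 : columnLaw m {a | ‖Fᗮ.starProjection (WithLp.toLp 2 a : EuclideanSpace ℝ (Fin m))‖ ^ 2 <
      β / 2} = (stdGaussian (EuclideanSpace ℝ (Fin m)))
        {x | ‖Fᗮ.starProjection ((√m)⁻¹ • x)‖ ^ 2 < β / 2} := by
    have := congrArg
      (fun ν => ν {x : EuclideanSpace ℝ (Fin m) | ‖Fᗮ.starProjection x‖ ^ 2 < β / 2})
      (columnLaw_map_toLp m)
    simp only at this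
    rwa [Measure.map_apply (by fun_prop) hms, Measure.map_apply (by fun_prop) hms] at this
  -- `hF` gives dim F^⊥ ≥ (4/5)βm. Hence (β/2)m is at most 5/8 of that dimension, and the rate 1/96
  -- becomes (4/5)/96 = 1/120.
  have h2 := stdGaussian_real_norm_sq_le (E := Fᗮ) (t := β / 2 * m) (by linarith)
  rw [← stdGaussian_map_orthogonalProjection,
    map_measureReal_apply (by fun_prop) (measurableSet_le (by fun_prop) (by fun_prop))] at h2
  rw [h1, ← ofReal_measureReal]
  refine ENNReal.ofReal_le_ofReal ?_
  refine ((measureReal_mono fun x hx => ?_).trans h2).trans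
    (Real.exp_le_exp.2 (by linarith))
  simp only [Set.mem_ofPred_eq, Set.mem_preimage, map_smul, norm_smul, mul_pow, norm_inv,
    Real.norm_eq_abs, inv_pow, sq_abs, Real.sq_sqrt hm'.le] at hx ⊢
  rw [inv_mul_eq_div, div_lt_iff₀ hm'] at hx
  exact hx.le

end Columns

/-! ### Measurability, and independence of an off-support column from the estimate. -/

section Independence

instance borelSpace_matrix {m n : ℕ} : BorelSpace (Matrix (Fin m) (Fin n) ℝ) :=
  inferInstanceAs (BorelSpace (Fin m → Fin n → ℝ))

instance secondCountableTopology_matrix {m n : ℕ} :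
    SecondCountableTopology (Matrix (Fin m) (Fin n) ℝ) :=
  inferInstanceAs (SecondCountableTopology (Fin m → Fin n → ℝ))

/-- The squared distance from `a` to the column space of `[B_T S]`. -/
noncomputable def augmentDistSq {m n r : ℕ} (T : Finset (Fin n)) (a : Fin m → ℝ)
    (B : Matrix (Fin m) (Fin n) ℝ) (S : Matrix (Fin m) (Fin r) ℝ) : ℝ :=
  ‖(colSpace (augment B T S))ᗮ.starProjection
    (WithLp.toLp 2 a : EuclideanSpace ℝ (Fin m))‖ ^ 2

/-- Writing the distance as an infimum over coefficients makes its strict sublevel sets unions of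
open sets. This gives joint measurability even though the projection can jump where the rank of [B_T
S] drops. -/
theorem augmentDistSq_lt_iff {m n r : ℕ} (T : Finset (Fin n)) (a : Fin m → ℝ)
    (B : Matrix (Fin m) (Fin n) ℝ) (S : Matrix (Fin m) (Fin r) ℝ) (t : ℝ) :
    augmentDistSq T a B S < t ↔ ∃ x : T ⊕ Fin r → ℝ,
      ∑ i, (a i - (augment B T S).mulVec x i) ^ 2 < t := by
  have h : ∀ x : T ⊕ Fin r → ℝ, ∑ i, (a i - (augment B T S).mulVec x i) ^ 2 =
      ‖(WithLp.toLp 2 a : EuclideanSpace ℝ (Fin m)) -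
        Matrix.toEuclideanLin (augment B T S) (WithLp.toLp 2 x)‖ ^ 2 := by
    intro x
    rw [EuclideanSpace.real_norm_sq_eq]
    simp
  constructor
  · intro hlt
    obtain ⟨x, hx⟩ := (colSpace (augment B T S)).starProjection_apply_mem
      (WithLp.toLp 2 a : EuclideanSpace ℝ (Fin m))
    refine ⟨WithLp.ofLp x, ?_⟩
    rw [h]
    simp only [WithLp.toLp_ofLp]
    rw [hx]
    rw [augmentDistSq, Submodule.starProjection_orthogonal_val] at hlt
    exact hlt
  · rintro ⟨x, hx⟩
    rw [h] at hx
    refine lt_of_le_of_lt ?_ hx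
    exact pow_le_pow_left₀ (norm_nonneg _)
      (norm_orthogonal_starProjection_le (colSpace (augment B T S)) _
        (LinearMap.mem_range_self _ (WithLp.toLp 2 x))) 2

theorem isOpen_augmentDistSq_lt {m n r : ℕ} (T : Finset (Fin n)) (t : ℝ) :
    IsOpen {p : (Fin m → ℝ) × (Matrix (Fin m) (Fin n) ℝ × Matrix (Fin m) (Fin r) ℝ) |
      augmentDistSq T p.1 p.2.1 p.2.2 < t} := by
  have : {p : (Fin m → ℝ) × (Matrix (Fin m) (Fin n) ℝ × Matrix (Fin m) (Fin r) ℝ) |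
      augmentDistSq T p.1 p.2.1 p.2.2 < t} = ⋃ x : T ⊕ Fin r → ℝ,
        {p | ∑ i, (p.1 i - (augment p.2.1 T p.2.2).mulVec x i) ^ 2 < t} := by
    ext p
    simp [augmentDistSq_lt_iff]
  rw [this]
  refine isOpen_iUnion fun x => isOpen_lt ?_ continuous_const
  simp only [augment, Matrix.mulVec, dotProduct, Fintype.sum_sum_type, Matrix.fromCols_apply_inl,
    Matrix.fromCols_apply_inr, Matrix.submatrix_apply, id]
  fun_prop

theorem measurable_matrix_iff {α : Type*} [MeasurableSpace α] {m n : ℕ}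
    {f : α → Matrix (Fin m) (Fin n) ℝ} :
    Measurable f ↔ ∀ i j, Measurable fun a => f a i j := by
  constructor
  · intro h i j
    exact (measurable_pi_apply j).comp ((measurable_pi_apply i).comp h)
  · intro h
    exact measurable_pi_lambda _ fun i => measurable_pi_lambda _ fun j => h i j

theorem measurable_matrix_mul {α : Type*} [MeasurableSpace α] {l m n : ℕ}
    {f : α → Matrix (Fin l) (Fin m) ℝ} {g : α → Matrix (Fin m) (Fin n) ℝ}
    (hf : Measurable f) (hg : Measurable g) : Measurable fun a => f a * g a := by
  rw [measurable_matrix_iff] at *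
  intro i j
  simp only [Matrix.mul_apply]
  exact Finset.measurable_sum _ fun k _ => (hf i k).mul (hg k j)

theorem measurable_matrix_add {α : Type*} [MeasurableSpace α] {m n : ℕ}
    {f g : α → Matrix (Fin m) (Fin n) ℝ}
    (hf : Measurable f) (hg : Measurable g) : Measurable fun a => f a + g a := by
  rw [measurable_matrix_iff] at *
  intro i j
  exact (hf i j).add (hg i j)

theorem indepFun_prodMk_of_indepFun_prodMk {Ω α β δ : Type*} [MeasurableSpace Ω]
    [MeasurableSpace α] [MeasurableSpace β] [MeasurableSpace δ] {μ : Measure Ω}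
    [IsProbabilityMeasure μ] {f : Ω → α} {g : Ω → β} {h : Ω → δ} (hf : AEMeasurable f μ)
    (hg : AEMeasurable g μ) (hh : AEMeasurable h μ) (hfg : IndepFun f g μ)
    (hfgh : IndepFun (fun ω => (f ω, g ω)) h μ) : IndepFun f (fun ω => (g ω, h ω)) μ := by
  have := Measure.isProbabilityMeasure_map hf
  have := Measure.isProbabilityMeasure_map hg
  have := Measure.isProbabilityMeasure_map hh
  have h2 : IndepFun g h μ := hfgh.comp measurable_snd measurable_id
  rw [indepFun_iff_map_prod_eq_prod_map_map (by fun_prop) (by fun_prop)] at *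
  rw [h2, ← Measure.prodAssoc_prod, ← hfg, ← hfgh, AEMeasurable.map_map_of_aemeasurable
    (by fun_prop) (by fun_prop)]
  rfl

variable {Ω : Type*} [MeasurableSpace Ω] {μ : Measure Ω} {m n : ℕ}
  {A : Ω → Matrix (Fin m) (Fin n) ℝ}

theorem IsGaussianSensing.aemeasurable_entry (hA : IsGaussianSensing μ A) (p : Fin m × Fin n) :
    AEMeasurable (fun ω => A ω p.1 p.2) μ :=
  (hA.2 p.1 p.2).aemeasurable

theorem IsGaussianSensing.aemeasurable (hA : IsGaussianSensing μ A) : AEMeasurable A μ :=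
  aemeasurable_pi_lambda _ fun i => aemeasurable_pi_lambda _ fun j => hA.aemeasurable_entry (i, j)

theorem IsGaussianSensing.map_column (hA : IsGaussianSensing μ A) (j : Fin n) :
    μ.map (fun ω i => A ω i j) = columnLaw m := by
  have h : iIndepFun (fun i ω => A ω i j) μ :=
    hA.1.precomp (g := fun i : Fin m => (i, j)) (fun a b h => congrArg Prod.fst h)
  rw [h.map_fun_eq_pi_map fun i => hA.aemeasurable_entry (i, j)]
  unfold columnLaw
  congr 1
  ext1 i
  exact (hA.2 i j).map_eq

/-- The matrix obtained from `A` by replacing column `j` by zero. -/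
def zeroCol {m n : ℕ} (j : Fin n) (A : Matrix (Fin m) (Fin n) ℝ) : Matrix (Fin m) (Fin n) ℝ :=
  fun i l => if l = j then 0 else A i l

theorem measurable_zeroCol {m n : ℕ} (j : Fin n) :
    Measurable (zeroCol j : Matrix (Fin m) (Fin n) ℝ → _) := by
  rw [measurable_matrix_iff]
  intro i l
  unfold zeroCol
  split_ifs
  · exact measurable_const
  · exact (measurable_matrix_iff.1 measurable_id) i l

/-- Column j meets only the zero row j of X. Hence Y, and with it the estimate, can be computed
without a_j. -/
theorem zeroCol_mul {N : ℕ} (j : Fin n) (A : Matrix (Fin m) (Fin n) ℝ)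
    {X : Matrix (Fin n) (Fin N) ℝ} (hj : j ∉ rowSupport X) : zeroCol j A * X = A * X := by
  have h0 : X j = 0 := by simpa [rowSupport] using hj
  ext i l
  simp only [Matrix.mul_apply, zeroCol]
  refine Finset.sum_congr rfl fun s _ => ?_
  split_ifs with hs
  · simp [hs, h0]
  · rfl

theorem IsGaussianSensing.indepFun_column [IsProbabilityMeasure μ] (hA : IsGaussianSensing μ A) (j : Fin n) :
    IndepFun (fun ω i => A ω i j) (fun ω => zeroCol j (A ω)) μ := by
  classical
  set P : Finset (Fin m × Fin n) := Finset.univ.filter fun p => p.2 = j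
  set R : Finset (Fin m × Fin n) := Finset.univ.filter fun p => p.2 ≠ j
  have hPR : Disjoint P R := by
    rw [Finset.disjoint_left]
    intro p hp hr
    exact (Finset.mem_filter.1 hr).2 (Finset.mem_filter.1 hp).2
  have h := hA.1.indepFun_finset₀ P R hPR hA.aemeasurable_entry
  have hφ : Measurable fun (f : P → ℝ) (i : Fin m) => f ⟨(i, j), by simp [P]⟩ := by fun_prop
  have hψ : Measurable fun (f : R → ℝ) =>
      (fun i l => if hl : l = j then 0 else f ⟨(i, l), by simp [R, hl]⟩ :
        Matrix (Fin m) (Fin n) ℝ) := by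
    refine measurable_pi_lambda _ fun i => measurable_pi_lambda _ fun l => ?_
    split_ifs
    · exact measurable_const
    · fun_prop
  have h2 := h.comp hφ hψ
  refine h2.congr (ae_of_all _ fun ω => rfl) (ae_of_all _ fun ω => ?_)
  ext i l
  simp [zeroCol]

theorem IsGaussianSensing.measure_norm_column_sq_gt_le (hA : IsGaussianSensing μ A) (hm : 0 < m)
    (j : Fin n) :
    μ {ω | 3 / 2 < ‖colVec (A ω) j‖ ^ 2} ≤ ENNReal.ofReal (Real.exp (-(m / 96 : ℝ))) := by
  have h := columnLaw_norm_sq_gt hm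
  rw [← hA.map_column j, Measure.map_apply_of_aemeasurable
    (aemeasurable_pi_lambda _ fun i => hA.aemeasurable_entry (i, j))
    (measurableSet_lt (by fun_prop) (by fun_prop))] at h
  exact h

/-- For an index `j` outside the row support of `X`, the column `a_j` is independent of the
signal subspace estimate, so its residual is bounded below with high probability. -/
theorem IsGaussianSensing.measure_residual_lt_le [IsProbabilityMeasure μ] (hA : IsGaussianSensing μ A) (hm : 0 < m)
    {N r : ℕ} {X : Matrix (Fin n) (Fin N) ℝ} {W : Ω → Matrix (Fin m) (Fin N) ℝ}
    {Q : Matrix (Fin m) (Fin N) ℝ → Matrix (Fin N) (Fin r) ℝ} (hW : AEMeasurable W μ)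
    (hAW : IndepFun A W μ) (hQ : Measurable Q) (I : Finset (Fin n)) {j : Fin n}
    (hj : j ∉ rowSupport X) {β : ℝ} (hdim : ((I.card + r : ℕ) : ℝ) + 4 / 5 * β * m ≤ m) :
    μ {ω | residual (A ω) ((A ω * X + W ω) * Q (A ω * X + W ω)) I j < β / 2} ≤
      ENNReal.ofReal (Real.exp (-(β * m / 120))) := by
  set g : Matrix (Fin m) (Fin n) ℝ × Matrix (Fin m) (Fin N) ℝ →
      Matrix (Fin m) (Fin n) ℝ × Matrix (Fin m) (Fin r) ℝ :=
    fun p => (p.1, (p.1 * X + p.2) * Q (p.1 * X + p.2)) with hg_def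
  have hg : Measurable g := by
    have h1 : Measurable fun p : Matrix (Fin m) (Fin n) ℝ × Matrix (Fin m) (Fin N) ℝ =>
        p.1 * X + p.2 :=
      measurable_matrix_add (measurable_matrix_mul measurable_fst measurable_const) measurable_snd
    exact measurable_fst.prodMk (measurable_matrix_mul h1 (hQ.comp h1))
  have hcol : AEMeasurable (fun ω i => A ω i j) μ :=
    aemeasurable_pi_lambda _ fun i => hA.aemeasurable_entry (i, j)
  have hB : AEMeasurable (fun ω => zeroCol j (A ω)) μ :=
    (measurable_zeroCol j).comp_aemeasurable hA.aemeasurable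
  have hcolm : Measurable fun M : Matrix (Fin m) (Fin n) ℝ => ((fun i => M i j), zeroCol j M) :=
    (measurable_pi_lambda _ fun i => (measurable_matrix_iff.1 measurable_id) i j).prodMk
      (measurable_zeroCol j)
  have hind : IndepFun (fun ω i => A ω i j) (fun ω => g (zeroCol j (A ω), W ω)) μ :=
    (indepFun_prodMk_of_indepFun_prodMk hcol hB hW (hA.indepFun_column j)
      (hAW.comp hcolm measurable_id)).comp measurable_id hg
  have hgm : AEMeasurable (fun ω => g (zeroCol j (A ω), W ω)) μ :=
    hg.comp_aemeasurable (hB.prodMk hW)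
  have := Measure.isProbabilityMeasure_map hgm
  rw [indepFun_iff_map_prod_eq_prod_map_map hcol hgm, hA.map_column j] at hind
  set O : Set ((Fin m → ℝ) × (Matrix (Fin m) (Fin n) ℝ × Matrix (Fin m) (Fin r) ℝ)) :=
    {p | augmentDistSq (I.erase j) p.1 p.2.1 p.2.2 < β / 2} with hO
  have hOm : MeasurableSet O := (isOpen_augmentDistSq_lt _ _).measurableSet
  -- `I.erase j` omits column j and AX does not see it, so the residual is a function of a_j and of
  -- data independent of a_j.
  have hset : {ω | residual (A ω) ((A ω * X + W ω) * Q (A ω * X + W ω)) I j < β / 2} =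
      (fun ω => ((fun i => A ω i j), g (zeroCol j (A ω), W ω))) ⁻¹' O := by
    ext ω
    have haug : ∀ S : Matrix (Fin m) (Fin r) ℝ,
        augment (zeroCol j (A ω)) (I.erase j) S = augment (A ω) (I.erase j) S := by
      intro S
      ext i l
      rcases l with l | l
      · simp [augment, zeroCol, Finset.ne_of_mem_erase l.2]
      · rfl
    simp only [hO, Set.mem_preimage, Set.mem_ofPred_eq, hg_def, zeroCol_mul j (A ω) hj,
      augmentDistSq, haug, residual]
  rw [hset, ← Measure.map_apply_of_aemeasurable (hcol.prodMk hgm) hOm, hind,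
    Measure.prod_apply_symm hOm]
  -- By Fubini the subspace may be frozen; the bound is uniform in it because only its dimension
  -- matters.
  have hbound : ∀ y, columnLaw m ((fun x => (x, y)) ⁻¹' O) ≤
      ENNReal.ofReal (Real.exp (-(β * m / 120))) := by
    intro y
    refine columnLaw_norm_projection_sq_lt hm (colSpace (augment y.1 (I.erase j) y.2)) ?_
    have h1 := finrank_colSpace_le (augment y.1 (I.erase j) y.2)
    have h2 : Fintype.card (I.erase j ⊕ Fin r) ≤ I.card + r := by
      rw [Fintype.card_sum, Fintype.card_coe, Fintype.card_fin]
      exact Nat.add_le_add_right Finset.card_erase_le r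
    have h3 : (Module.finrank ℝ (colSpace (augment y.1 (I.erase j) y.2)) : ℝ) ≤
        ((I.card + r : ℕ) : ℝ) := by exact_mod_cast h1.trans h2
    linarith
  calc _ ≤ ∫⁻ _, ENNReal.ofReal (Real.exp (-(β * m / 120)))
        ∂(μ.map fun ω => g (zeroCol j (A ω), W ω)) := lintegral_mono hbound
    _ = _ := by simp

end Independence

/-! ### Union bound and Borel–Cantelli. -/

section Asymptotics

theorem IsGaussianSensing.measure_exists_bad_column_le {Ω : Type*} [MeasurableSpace Ω]
    {μ : Measure Ω} [IsProbabilityMeasure μ] {m n : ℕ} {A : Ω → Matrix (Fin m) (Fin n) ℝ}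
    (hA : IsGaussianSensing μ A) (hm : 0 < m)
    {N r : ℕ} {X : Matrix (Fin n) (Fin N) ℝ} {W : Ω → Matrix (Fin m) (Fin N) ℝ}
    {Q : Matrix (Fin m) (Fin N) ℝ → Matrix (Fin N) (Fin r) ℝ} (hW : AEMeasurable W μ)
    (hAW : IndepFun A W μ) (hQ : Measurable Q) (I : Finset (Fin n))
    {β : ℝ} (hβ1 : β ≤ 1) (hdim : ((I.card + r : ℕ) : ℝ) + 4 / 5 * β * m ≤ m) :
    μ {ω | ¬ ((∀ j, ‖colVec (A ω) j‖ ^ 2 ≤ 3 / 2) ∧ ∀ j ∉ rowSupport X,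
        β / 2 ≤ residual (A ω) ((A ω * X + W ω) * Q (A ω * X + W ω)) I j)} ≤
      ENNReal.ofReal (2 * n * Real.exp (-(β * m / 120))) := by
  set e := Real.exp (-(β * m / 120))
  have hsub : {ω | ¬ ((∀ j, ‖colVec (A ω) j‖ ^ 2 ≤ 3 / 2) ∧ ∀ j ∉ rowSupport X,
        β / 2 ≤ residual (A ω) ((A ω * X + W ω) * Q (A ω * X + W ω)) I j)} ⊆
      ⋃ j : Fin n, ({ω | 3 / 2 < ‖colVec (A ω) j‖ ^ 2} ∪ {ω | j ∉ rowSupport X ∧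
        residual (A ω) ((A ω * X + W ω) * Q (A ω * X + W ω)) I j < β / 2}) := by
    intro ω hω
    simp only [Set.mem_ofPred_eq, not_and_or, not_forall, not_le] at hω
    rw [Set.mem_iUnion]
    rcases hω with ⟨j, hj⟩ | ⟨j, hj, hlt⟩
    · exact ⟨j, Or.inl hj⟩
    · exact ⟨j, Or.inr ⟨hj, hlt⟩⟩
  have hj : ∀ j : Fin n, μ ({ω | 3 / 2 < ‖colVec (A ω) j‖ ^ 2} ∪ {ω | j ∉ rowSupport X ∧
        residual (A ω) ((A ω * X + W ω) * Q (A ω * X + W ω)) I j < β / 2}) ≤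
      ENNReal.ofReal (2 * e) := by
    intro j
    rw [two_mul, ENNReal.ofReal_add (Real.exp_pos _).le (Real.exp_pos _).le]
    refine (measure_union_le _ _).trans (add_le_add ?_ ?_)
    · refine (hA.measure_norm_column_sq_gt_le hm j).trans (ENNReal.ofReal_le_ofReal ?_)
      rw [Real.exp_le_exp]
      have : β * m ≤ 1 * m := by gcongr
      have : (0 : ℝ) ≤ m := Nat.cast_nonneg _
      linarith
    · by_cases hjs : j ∈ rowSupport X
      · simp [hjs]
      · simpa [hjs] using hA.measure_residual_lt_le hm hW hAW hQ I hjs hdim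
  calc _ ≤ _ := measure_mono hsub
    _ ≤ ∑ j : Fin n, _ := measure_iUnion_fintype_le _ _
    _ ≤ ∑ _j : Fin n, ENNReal.ofReal (2 * e) := Finset.sum_le_sum fun j _ => hj j
    _ = ENNReal.ofReal (2 * n * e) := by
      rw [Finset.sum_const, Finset.card_univ, Fintype.card_fin, nsmul_eq_mul,
        ← ENNReal.ofReal_natCast, ← ENNReal.ofReal_mul (Nat.cast_nonneg _)]
      ring_nf

/-- If the failure probabilities are eventually at most `2 / n²`, the events hold with probability
tending to one and, by Borel–Cantelli, almost surely for all large indices. -/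
theorem tendsto_measure_not_and_ae_eventually {Ω : Type*} [MeasurableSpace Ω] {μ : Measure Ω}
    {p : ℕ → Ω → Prop}
    (h : ∀ᶠ n : ℕ in atTop, μ {ω | ¬ p n ω} ≤ ENNReal.ofReal (2 / (n : ℝ) ^ 2)) :
    Tendsto (fun n => μ {ω | ¬ p n ω}) atTop (𝓝 0) ∧ ∀ᵐ ω ∂μ, ∀ᶠ n in atTop, p n ω := by
  have hsum : Summable fun n : ℕ => 2 / (n : ℝ) ^ 2 := by
    simpa [div_eq_mul_inv] using (Real.summable_nat_pow_inv.2 one_lt_two).mul_left 2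
  constructor
  · refine tendsto_of_tendsto_of_tendsto_of_le_of_le' tendsto_const_nhds ?_
      (Eventually.of_forall fun _ => zero_le) h
    have := ENNReal.tendsto_ofReal hsum.tendsto_atTop_zero
    rwa [ENNReal.ofReal_zero] at this
  · obtain ⟨n₀, hn₀⟩ := eventually_atTop.1 h
    -- The conjunct `n₀ ≤ n` empties the finitely many events for which no bound is known.
    have hfin : ∑' n, μ {ω | n₀ ≤ n ∧ ¬ p n ω} ≠ ⊤ := by
      refine ne_top_of_le_ne_top hsum.tsum_ofReal_ne_top (ENNReal.tsum_le_tsum fun n => ?_)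
      by_cases hn : n₀ ≤ n
      · simpa [hn] using hn₀ n hn
      · simp [hn]
    filter_upwards [ae_eventually_notMem hfin] with ω hω
    filter_upwards [hω, eventually_ge_atTop n₀] with n hn hn0
    by_contra hcon
    exact hn ⟨hn0, hcon⟩

/-- Since 360 = 3 · 120, log n < βm/360 makes the exponential at most n⁻³; the factor 2n then leaves
a summable 2/n². -/
theorem eventually_mul_exp_neg_le {m : ℕ → ℕ} {β : ℝ} (hβ : 0 < β) (hm : Tendsto m atTop atTop)
    (hlog : Tendsto (fun n : ℕ => Real.log n / m n) atTop (𝓝 0)) :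
    ∀ᶠ n : ℕ in atTop, 2 * n * Real.exp (-(β * m n / 120)) ≤ 2 / (n : ℝ) ^ 2 := by
  filter_upwards [hlog.eventually_lt_const (show 0 < β / 360 by positivity),
    hm.eventually_gt_atTop 0, eventually_gt_atTop 0] with n hn hm0 hn0
  have hm' : (0 : ℝ) < m n := by exact_mod_cast hm0
  have hn' : (0 : ℝ) < n := by exact_mod_cast hn0
  rw [div_lt_iff₀ hm'] at hn
  have h1 : Real.exp (-(β * m n / 120)) ≤ ((n : ℝ) ^ 3)⁻¹ := by
    rw [← Real.exp_log (show (0 : ℝ) < ((n : ℝ) ^ 3)⁻¹ by positivity), Real.exp_le_exp,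
      Real.log_inv, Real.log_pow]
    push_cast
    linarith
  calc 2 * n * Real.exp (-(β * m n / 120)) ≤ 2 * n * ((n : ℝ) ^ 3)⁻¹ := by gcongr
    _ = 2 / (n : ℝ) ^ 2 := by field_simp

end Asymptotics

end SeqMusic

theorem mainTheorem7 {Ω : Type*} [MeasurableSpace Ω] (μ : Measure Ω) [IsProbabilityMeasure μ]
    (m k r N : ℕ → ℕ) (γ α : ℝ)
    (A : (n : ℕ) → Ω → Matrix (Fin (m n)) (Fin n) ℝ)
    (X : (n : ℕ) → Matrix (Fin n) (Fin (N n)) ℝ)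
    (W : (n : ℕ) → Ω → Matrix (Fin (m n)) (Fin (N n)) ℝ)
    (Y : (n : ℕ) → Ω → Matrix (Fin (m n)) (Fin (N n)) ℝ)
    (Q : (n : ℕ) → Matrix (Fin (m n)) (Fin (N n)) ℝ → Matrix (Fin (N n)) (Fin (r n)) ℝ)
    (S St : (n : ℕ) → Ω → Matrix (Fin (m n)) (Fin (r n)) ℝ)
    (I : (n : ℕ) → Finset (Fin n))
    -- the large system limit
    (hm : Tendsto m atTop atTop)
    (hlog : Tendsto (fun n : ℕ => Real.log n / m n) atTop (𝓝 0))
    (hγ : Tendsto (fun n => (k n : ℝ) / m n) atTop (𝓝 γ))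
    (hα : Tendsto (fun n => (r n : ℝ) / k n) atTop (𝓝 α))
    (hγα : γ * (1 + α) < 1)
    -- Gaussian sensing matrices and independent noise, `Y = A X + W`
    (hA : ∀ n, SeqMusic.IsGaussianSensing μ (A n))
    (hW : ∀ n, AEMeasurable (W n) μ)
    (hAW : ∀ n, IndepFun (A n) (W n) μ)
    (hY : ∀ n ω, Y n ω = A n ω * X n + W n ω)
    -- the signal subspace estimate `St = Y Q(Y) = A (X Q(Y)) + W Q(Y)`, and `R(S) = R(A (X Q(Y)))`
    (hQ : ∀ n, Measurable (Q n))
    (hSVD : ∀ᶠ n in atTop, ∀ᵐ ω ∂μ, SeqMusic.IsSVDReduction (Y n ω) (Q n (Y n ω)))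
    (hSt : ∀ n ω, St n ω = Y n ω * Q n (Y n ω))
    (hS : ∀ n ω, SeqMusic.colSpace (S n ω) =
      SeqMusic.colSpace (A n ω * (X n * Q n (Y n ω))))
    -- sizes
    (hr : ∀ᶠ n in atTop, r n ≤ k n)
    (hkr : ∀ᶠ n in atTop, k n + r n ≤ m n)
    (hX : ∀ᶠ n in atTop, (SeqMusic.rowSupport (X n)).card = k n)
    (hI : ∀ᶠ n in atTop, (I n).card = k n)
    (hIC : ∀ᶠ n in atTop, k n - r n + 1 ≤ (SeqMusic.rowSupport (X n) ∩ I n).card) :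
    Tendsto (fun n => μ {ω | ¬ SeqMusic.FilteringSucceedsIfSNR (k n)
        (1 + 1 / (1 - γ * (1 + α))) (A n ω) (SeqMusic.rowSupport (X n)) (I n)
        (S n ω) (St n ω)}) atTop (𝓝 0) ∧
    ∀ᵐ ω ∂μ, ∀ᶠ n in atTop, SeqMusic.FilteringSucceedsIfSNR (k n)
        (1 + 1 / (1 - γ * (1 + α))) (A n ω) (SeqMusic.rowSupport (X n)) (I n)
        (S n ω) (St n ω) := by
  set β := 1 - γ * (1 + α) with hβ_def
  have hβ : 0 < β := by linarith
  have hγ0 : 0 ≤ γ := ge_of_tendsto' hγ fun n => by positivity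
  have hα0 : 0 ≤ α := ge_of_tendsto' hα fun n => by positivity
  have hβ1 : β ≤ 1 := by
    have : 0 ≤ γ * (1 + α) := by positivity
    linarith
  have hratio : Tendsto (fun n => ((k n : ℝ) + r n) / m n) atTop (𝓝 (1 - β)) := by
    have h1 : Tendsto (fun n => (k n : ℝ) / m n * (1 + (r n : ℝ) / k n)) atTop
        (𝓝 (γ * (1 + α))) := hγ.mul (hα.const_add 1)
    rw [hβ_def, sub_sub_cancel]
    refine h1.congr' ?_
    filter_upwards [hr] with n hn
    -- If k = 0 the quotient r/k takes the default value 0, but r ≤ k makes r vanish as well.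
    rcases Nat.eq_zero_or_pos (k n) with h0 | h0
    · have : r n = 0 := by omega
      simp [h0, this]
    · have : (k n : ℝ) ≠ 0 := by exact_mod_cast h0.ne'
      field_simp
  apply SeqMusic.tendsto_measure_not_and_ae_eventually
  filter_upwards [SeqMusic.eventually_mul_exp_neg_le hβ hm hlog, hm.eventually_gt_atTop 0, hr, hX,
    -- The gap between β and 4β/5 absorbs the error in (k + r)/m → 1 - β.
    hI, hIC, hratio.eventually_lt_const (show 1 - β < 1 - 4 / 5 * β by linarith)]
    with n hexp hm0 hrn hXn hIn hICn hrat
  have hm' : (0 : ℝ) < m n := by exact_mod_cast hm0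
  have hdim : (((I n).card + r n : ℕ) : ℝ) + 4 / 5 * β * m n ≤ m n := by
    rw [div_lt_iff₀ hm'] at hrat
    rw [hIn]
    push_cast
    linarith
  -- The failure set need not be measurable; it suffices that it lies in the bad-column event.
  refine le_trans (measure_mono fun ω hω => ?_) (((hA n).measure_exists_bad_column_le hm0 (hW n)
    (hAW n) (hQ n) (I n) (X := X n) hβ1 hdim).trans (ENNReal.ofReal_le_ofReal hexp))
  refine fun hgood => hω ?_
  refine SeqMusic.filteringSucceedsIfSNR_of_bounds hβ (A n ω) (S n ω) (St n ω) hXn hrn hICn ?_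
    hgood.1 ?_
  · rw [hS]
    exact SeqMusic.colSpace_mul_le_span_rowSupport _ _ _
  · rw [hSt, hY]
    exact hgood.2
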